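/- Let $G$ be a simple graph, finite or infinite. A cycle $C$ in $G$ is \emph{geodesic} if, for any two vertices of $C$, it contains a shortest path of $G$ between them. Let $\ell(G)$ be the smallest natural number $\ell$ such that the cycles of $G$ of length at most $\ell$ generate the cycle space of $G$ over $\mathbb{F}_2$ (the subspace of the edge space $\mathbb{F}_2^{E(G)}$ spanned by the edge sets of all cycles of $G$). Let $\mathrm{tw}(G)$ be the tree-width of $G$, that is, the minimum over all tree-decompositions $(T,(V_t)_{t\in T})$ of $G$ of the width $\max_{t\in T}(|V_t|-1)$. (For infinite $G$ these parameters may be $\infty$, with $k/\infty=0$; for finite $G$ they are natural numbers.) If $G$ contains a geodesic cycle of length $k$, then $$\mathrm{tw}(G)\ \ge\ \frac{k}{\ell(G)}.$$ -/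

import Mathlib

open scoped ENNReal

universe u

namespace SimpleGraph

variable {V : Type u}

/-- A tree-decomposition of a graph `G`: a tree together with a family of vertex sets of `G`
(the parts), one for every node of the tree, satisfying (T1), (T2), (T3). -/
structure TreeDecomposition (G : SimpleGraph V) where
  /-- the nodes of the tree -/
  node : Type u
  /-- the tree -/
  tree : SimpleGraph node
  isTree : tree.IsTree
  /-- the part at a node -/
  part : node → Set V
  /-- (T1) the parts cover the vertex set -/
  exists_mem_part : ∀ v : V, ∃ t, v ∈ part t
  /-- (T2) every edge lies in a part -/
  exists_edge_mem_part : ∀ v w : V, G.Adj v w → ∃ t, v ∈ part t ∧ w ∈ part t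
  /-- (T3) whenever `t₂` lies on the path in the tree from `t₁` to `t₃` -/
  part_inter_part_subset : ∀ (t₁ t₂ t₃ : node) (p : tree.Walk t₁ t₃), p.IsPath →
    t₂ ∈ p.support → part t₁ ∩ part t₃ ⊆ part t₂

/-- The width `max (|V_t| - 1)`, which is `⊤` when there is no finite bound. -/
noncomputable def TreeDecomposition.width {G : SimpleGraph V} (D : G.TreeDecomposition) : ℕ∞ :=
  ⨆ t : D.node, ((D.part t).encard - 1)

/-- The tree-width: the minimum width of a tree-decomposition. -/
noncomputable def treeWidth (G : SimpleGraph V) : ℕ∞ :=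
  ⨅ D : G.TreeDecomposition, D.width

/-- The element of the edge space of `G` over the two-element field given by the edge set
of a closed walk (used for cycles). -/
noncomputable def edgeVector (G : SimpleGraph V) {v : V} (c : G.Walk v v) :
    G.edgeSet → ZMod 2 :=
  Set.indicator {e : G.edgeSet | (e : Sym2 V) ∈ c.edges} 1

/-- The cycle space of `G`: the subspace of the edge space generated by all cycles. -/
noncomputable def cycleSpace (G : SimpleGraph V) : Submodule (ZMod 2) (G.edgeSet → ZMod 2) :=
  Submodule.span (ZMod 2)
    {x | ∃ (v : V) (c : G.Walk v v), c.IsCycle ∧ x = G.edgeVector c}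

/-- The subspace of the edge space generated by the cycles of length at most `n`. -/
noncomputable def shortCycleSpan (G : SimpleGraph V) (n : ℕ) :
    Submodule (ZMod 2) (G.edgeSet → ZMod 2) :=
  Submodule.span (ZMod 2)
    {x | ∃ (v : V) (c : G.Walk v v), c.IsCycle ∧ c.length ≤ n ∧ x = G.edgeVector c}

/-- The parameter `ℓ(G)`: the smallest natural number `n` such that the cycles of length at
most `n` generate the cycle space of `G` (it is `⊤` if there is none, which can only happen for
infinite `G`). -/
noncomputable def cycleGenLength (G : SimpleGraph V) : ℕ∞ :=
  ⨅ (n : ℕ) (_ : G.shortCycleSpan n = G.cycleSpace), (n : ℕ∞)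

/-- A geodesic cycle in `G`: a cycle that contains a shortest path in `G` between any two of
its vertices. -/
def IsGeodesicCycle (G : SimpleGraph V) {v : V} (c : G.Walk v v) : Prop :=
  c.IsCycle ∧ ∀ x ∈ c.support, ∀ y ∈ c.support,
    ∃ p : G.Walk x y, p.IsPath ∧ p.length = G.dist x y ∧ p.toSubgraph ≤ c.toSubgraph

end SimpleGraph

/-! Work with finite edge chains over the two-element field. Suppose all parts have at most `w + 1`
vertices and the geodesic cycle `c` has length `k > w * l`, where cycles of length at most `l`
generate. Fix a part `X` and consider the edge sets that split at `X`; call one light if it contains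
at most half of `c`.

Suppose two disjoint light sets had a union that is not light. Together with the complement they cut
`c` into three light pieces, whose boundaries lie on `X` and sum to zero. Since `c` is a sum of
short cycles, these boundaries lie in the span of pairs from `X` joined by at most `l / 2` edges
(`IsSplitting.boundary_mem_span`). A basis of such pairs has at most `w` elements, and each is used
by none or two of the three boundaries, so chains with the same boundaries exist with at most `w *
l` edges in total (`exists_three_joins`). But a light piece of a geodesic cycle is a shortest chain
with its boundary (`IsGeodesicCycle.card_support_le`), so `k ≤ w * l`, a contradiction.

Hence light splitting sets cannot cover `c`, and every tree node has a branch carrying more than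
half of `c` (`exists_heavy_branch`). Adjacent nodes cannot point at each other, so the heavy
branches lead along an endless path in the tree, impossible because `c` is finite. -/

namespace SimpleGraph

/-! ### Finite chains over the two-element field -/

section Chains

variable {V : Type u}

/-- The boundary map from finite edge chains to finite vertex chains. -/
noncomputable def boundary : (Sym2 V →₀ ZMod 2) →ₗ[ZMod 2] (V →₀ ZMod 2) :=
  Finsupp.linearCombination (ZMod 2) (Sym2.lift
    ⟨fun a b => Finsupp.single a 1 + Finsupp.single b 1, fun _ _ => add_comm _ _⟩)

theorem boundary_single (a b : V) (r : ZMod 2) :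
    boundary (Finsupp.single s(a, b) r) = r • (Finsupp.single a 1 + Finsupp.single b 1) := by
  simp [boundary]

/-- The sum of the coefficients of a vertex chain over a set of vertices. -/
noncomputable def coeffSum (K : Set V) : (V →₀ ZMod 2) →ₗ[ZMod 2] ZMod 2 :=
  Finsupp.linearCombination (ZMod 2) (K.indicator 1)

open Classical in
theorem coeffSum_single (K : Set V) (a : V) (r : ZMod 2) :
    coeffSum K (Finsupp.single a r) = if a ∈ K then r else 0 := by
  simp [coeffSum, Set.indicator_apply]

open Classical in
/-- The restriction of an edge chain to a set of edges. -/
noncomputable def chainRestrict (A : Set (Sym2 V)) :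
    (Sym2 V →₀ ZMod 2) →ₗ[ZMod 2] (Sym2 V →₀ ZMod 2) where
  toFun c := c.filter (· ∈ A)
  map_add' _ _ := Finsupp.filter_add
  map_smul' _ _ := Finsupp.filter_smul

open Classical in
theorem chainRestrict_apply (A : Set (Sym2 V)) (c : Sym2 V →₀ ZMod 2) (e : Sym2 V) :
    chainRestrict A c e = if e ∈ A then c e else 0 := by
  simp [chainRestrict, Finsupp.filter_apply]

theorem zmod_two_eq_one_of_ne_zero {a : ZMod 2} (h : a ≠ 0) : a = 1 := by
  revert a; decide

theorem chain_add_self {α : Type*} (c : α →₀ ZMod 2) : c + c = 0 := by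
  ext a
  exact CharTwo.add_self_eq_zero _

theorem eq_of_chain_add_eq_zero {α : Type*} {c d : α →₀ ZMod 2} (h : c + d = 0) : c = d := by
  ext a
  exact CharTwo.add_eq_zero.1 (DFunLike.congr_fun h a)

/-- Each edge of `c` has both ends in `K`, contributing `1 + 1 = 0`, or neither. With `K` a
component this is the handshake lemma. -/
theorem coeffSum_boundary_eq_zero (K : Set V) (c : Sym2 V →₀ ZMod 2)
    (h : ∀ a b, s(a, b) ∈ c.support → (a ∈ K ↔ b ∈ K)) : coeffSum K (boundary c) = 0 := by
  classical
  rw [boundary, Finsupp.linearCombination_apply, Finsupp.sum, map_sum]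
  refine Finset.sum_eq_zero fun e he => ?_
  induction e with | _ a b
  have := h a b he
  by_cases ha : a ∈ K
  · have hb := this.1 ha
    simp [coeffSum_single, ha, hb, CharTwo.add_self_eq_zero]
  · have hb : b ∉ K := fun hb => ha (this.2 hb)
    simp [coeffSum_single, ha, hb]

theorem coeffSum_univ_boundary (c : Sym2 V →₀ ZMod 2) : coeffSum Set.univ (boundary c) = 0 :=
  coeffSum_boundary_eq_zero _ _ fun _ _ _ => by simp

theorem boundary_apply_eq_zero (c : Sym2 V →₀ ZMod 2) (v : V)
    (h : ∀ w, c s(v, w) = 0) : boundary c v = 0 := by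
  classical
  rw [boundary, Finsupp.linearCombination_apply, Finsupp.sum, Finsupp.finsetSum_apply]
  refine Finset.sum_eq_zero fun e he => ?_
  induction e with | _ a b
  by_cases ha : a = v
  · subst ha; simp [h b] at he
  by_cases hb : b = v
  · subst hb; rw [Sym2.eq_swap] at he; simp [h a] at he
  simp [ha, hb]

theorem boundary_apply_congr {c d : Sym2 V →₀ ZMod 2} {v : V}
    (h : ∀ w, c s(v, w) = d s(v, w)) : boundary c v = boundary d v := by
  have := boundary_apply_eq_zero (c - d) v fun w => by simp [h w]
  rw [map_sub, Finsupp.sub_apply, sub_eq_zero] at this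
  exact this

variable {G : SimpleGraph V}

/-- The edge chain of a walk. -/
noncomputable def Walk.chain {u v : V} (p : G.Walk u v) : Sym2 V →₀ ZMod 2 :=
  (p.edges.map fun e => Finsupp.single e 1).sum

@[simp] theorem Walk.chain_nil (u : V) : (Walk.nil : G.Walk u u).chain = 0 := by
  simp [Walk.chain]

@[simp] theorem Walk.chain_cons {u v w : V} (h : G.Adj u v) (p : G.Walk v w) :
    (Walk.cons h p).chain = Finsupp.single s(u, v) 1 + p.chain := by
  simp [Walk.chain]

theorem Walk.boundary_chain {u v : V} (p : G.Walk u v) :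
    boundary p.chain = Finsupp.single u 1 + Finsupp.single v 1 := by
  induction p with
  | nil => simp [chain_add_self]
  | @cons u v w h p ih =>
    rw [Walk.chain_cons, map_add, ih, boundary_single, one_smul]
    have := chain_add_self (Finsupp.single v (1 : ZMod 2))
    calc _ = Finsupp.single u 1 + (Finsupp.single v 1 + Finsupp.single v 1)
            + Finsupp.single w (1 : ZMod 2) := by abel
      _ = _ := by rw [this, add_zero]

theorem Walk.chain_apply_of_notMem {u v : V} (p : G.Walk u v) {e : Sym2 V} (he : e ∉ p.edges) :
    p.chain e = 0 := by
  induction p with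
  | nil => simp
  | cons h p ih =>
    rw [Walk.edges_cons, List.mem_cons, not_or] at he
    simp [ih he.2, Ne.symm he.1]

theorem Walk.chain_apply_of_mem {u v : V} (p : G.Walk u v) (hp : p.IsTrail) {e : Sym2 V}
    (he : e ∈ p.edges) : p.chain e = 1 := by
  induction p with
  | nil => simp at he
  | cons h p ih =>
    rw [Walk.isTrail_cons] at hp
    rw [Walk.edges_cons, List.mem_cons] at he
    rcases he with rfl | he
    · simp [p.chain_apply_of_notMem hp.2]
    · have hne := ne_of_mem_of_not_mem he hp.2
      simp [ih hp.1 he, hne.symm]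

theorem Walk.mem_edges_of_chain_ne_zero {u v : V} (p : G.Walk u v) {e : Sym2 V}
    (he : p.chain e ≠ 0) : e ∈ p.edges := by
  by_contra h
  exact he (p.chain_apply_of_notMem h)

open Classical in
theorem Walk.support_chain_subset {u v : V} (p : G.Walk u v) :
    p.chain.support ⊆ p.edges.toFinset := fun _ he =>
  List.mem_toFinset.2 (p.mem_edges_of_chain_ne_zero (Finsupp.mem_support_iff.1 he))

theorem Walk.card_support_chain_le {u v : V} (p : G.Walk u v) :
    p.chain.support.card ≤ p.length := by
  classical
  refine (Finset.card_le_card p.support_chain_subset).trans ?_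
  exact (List.toFinset_card_le _).trans p.length_edges.le

open Classical in
theorem Walk.IsTrail.support_chain {u v : V} {p : G.Walk u v} (hp : p.IsTrail) :
    p.chain.support = p.edges.toFinset := by
  refine subset_antisymm p.support_chain_subset fun _ he => ?_
  rw [Finsupp.mem_support_iff, p.chain_apply_of_mem hp (List.mem_toFinset.1 he)]
  exact one_ne_zero

theorem Walk.IsTrail.card_support_chain {u v : V} {p : G.Walk u v} (hp : p.IsTrail) :
    p.chain.support.card = p.length := by
  classical
  rw [hp.support_chain, List.toFinset_card_of_nodup hp.edges_nodup, p.length_edges]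

/-- A chain carried by a path whose boundary vanishes off the ends is a multiple of the path. -/
theorem Walk.IsPath.chain_eq_smul {u v : V} {p : G.Walk u v} (hp : p.IsPath)
    (z : Sym2 V →₀ ZMod 2) (hz : ∀ e, z e ≠ 0 → e ∈ p.edges)
    (hb : ∀ x, x ≠ u → x ≠ v → boundary z x = 0) : ∃ a : ZMod 2, z = a • p.chain := by
  induction p generalizing z with
  | nil =>
    refine ⟨0, ?_⟩
    ext e
    by_contra h
    simpa using hz e (by simpa using h)
  | @cons u v w h p ih =>
    rw [Walk.cons_isPath_iff] at hp
    set a := z s(u, v)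
    set z' := z - Finsupp.single s(u, v) a with hz'
    have hzz : z = Finsupp.single s(u, v) a + z' := by rw [hz']; abel
    have hz'0 : z' s(u, v) = 0 := by simp [hz', a]
    have hsupp : ∀ e, z' e ≠ 0 → e ∈ p.edges := by
      intro e he
      have hne : s(u, v) ≠ e := fun h' => he (h' ▸ hz'0)
      have : z e ≠ 0 := by
        simpa [hz', Finsupp.single_apply, hne] using he
      have := hz e this
      rw [Walk.edges_cons, List.mem_cons] at this
      exact this.resolve_left (Ne.symm hne)
    have hu0 : boundary z' u = 0 := by
      refine boundary_apply_eq_zero _ _ fun x => ?_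
      by_contra hx
      exact hp.2 (p.fst_mem_support_of_mem_edges (hsupp _ hx))
    have hbz : boundary z = a • (Finsupp.single u 1 + Finsupp.single v 1) + boundary z' := by
      conv_lhs => rw [hzz]
      rw [map_add, boundary_single]
    obtain ⟨b, hb'⟩ := ih hp.1 z' hsupp fun x hxv hxw => by
      by_cases hxu : x = u
      · rw [hxu, hu0]
      have := hb x hxu hxw
      rw [hbz] at this
      simpa [Finsupp.single_apply, Ne.symm hxu, Ne.symm hxv] using this
    refine ⟨a, ?_⟩
    -- If `v` is the end of the path, nothing is known about the boundary there, but then the first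
    -- edge is the whole path. Otherwise the boundary at `v` is `a + b`.
    by_cases hvw : v = w
    · subst hvw
      have : p = Walk.nil := by
        simpa using hp.1
      subst this
      rw [hzz, hb']
      simp
    · have h1 := hb v (G.ne_of_adj h).symm hvw
      rw [hbz, hb', map_smul, p.boundary_chain] at h1
      have : a + b = 0 := by
        simpa [Finsupp.single_apply, G.ne_of_adj h, hvw, Ne.symm hvw] using h1
      have hab : a = b := CharTwo.add_eq_zero.1 this
      rw [hzz, hb', Walk.chain_cons, smul_add, hab]
      simp

/-- A chain without boundary carried by a cycle is zero or the whole cycle. -/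
theorem Walk.IsCycle.chain_eq_zero_or_eq {u : V} {c : G.Walk u u} (hc : c.IsCycle)
    (z : Sym2 V →₀ ZMod 2) (hz : ∀ e, z e ≠ 0 → e ∈ c.edges) (hb : boundary z = 0) :
    z = 0 ∨ z = c.chain := by
  cases c with
  | nil => exact absurd rfl hc.ne_nil
  | @cons _ v _ h p =>
    rw [Walk.cons_isCycle_iff] at hc
    set a := z s(u, v)
    set z' := z - Finsupp.single s(u, v) a with hz'
    have hzz : z = Finsupp.single s(u, v) a + z' := by rw [hz']; abel
    have hz'0 : z' s(u, v) = 0 := by simp [hz', a]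
    have hsupp : ∀ e, z' e ≠ 0 → e ∈ p.edges := by
      intro e he
      have hne : s(u, v) ≠ e := fun h' => he (h' ▸ hz'0)
      have : z e ≠ 0 := by
        simpa [hz', Finsupp.single_apply, hne] using he
      have := hz e this
      rw [Walk.edges_cons, List.mem_cons] at this
      exact this.resolve_left (Ne.symm hne)
    have hbz : boundary z = a • (Finsupp.single u 1 + Finsupp.single v 1) + boundary z' := by
      conv_lhs => rw [hzz]
      rw [map_add, boundary_single]
    obtain ⟨b, hb'⟩ := hc.1.chain_eq_smul z' hsupp fun x hxv hxw => by
      have := DFunLike.congr_fun hb x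
      rw [hbz] at this
      simpa [Finsupp.single_apply, Ne.symm hxw, Ne.symm hxv] using this
    have h1 := DFunLike.congr_fun hb v
    rw [hbz, hb', map_smul, p.boundary_chain] at h1
    have hab : a = b := CharTwo.add_eq_zero.1 (by
      simpa [Finsupp.single_apply, G.ne_of_adj h] using h1)
    have hz2 : z = b • (Walk.cons h p).chain := by
      rw [hzz, hb', Walk.chain_cons, smul_add, hab]
      simp
    by_cases hb0 : b = 0
    · left; rw [hz2, hb0, zero_smul]
    · right; rw [hz2, zmod_two_eq_one_of_ne_zero hb0, one_smul]

end Chains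

/-! ### Chains carried by a geodesic cycle -/

section Geodesic

variable {V : Type u} {G : SimpleGraph V}

theorem boundary_apply_eq_zero_of_notMem_support {u v : V} (p : G.Walk u v)
    {J : Sym2 V →₀ ZMod 2} (hJ : ∀ e, J e ≠ 0 → e ∈ p.edges) {x : V} (hx : x ∉ p.support) :
    boundary J x = 0 :=
  boundary_apply_eq_zero _ _ fun y => by
    by_contra h
    exact hx (p.fst_mem_support_of_mem_edges (hJ _ h))

theorem card_support_add_le {α : Type*} (c d : α →₀ ZMod 2) :
    (c + d).support.card ≤ c.support.card + d.support.card := by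
  classical
  exact (Finset.card_le_card Finsupp.support_add).trans (Finset.card_union_le _ _)

/-- A path inside the support of a chain can be split off from it. -/
theorem card_support_add_chain {u v : V} {p : G.Walk u v} (hp : p.IsTrail)
    {P : Sym2 V →₀ ZMod 2} (h : ∀ e ∈ p.edges, P e ≠ 0) :
    (P + p.chain).support.card + p.length = P.support.card := by
  classical
  have : (P + p.chain).support = P.support \ p.chain.support := by
    ext e
    by_cases he : e ∈ p.edges
    · have h1 := zmod_two_eq_one_of_ne_zero (h e he)
      simp [h1, p.chain_apply_of_mem hp he, CharTwo.add_self_eq_zero]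
    · simp [p.chain_apply_of_notMem he]
  rw [this, ← hp.card_support_chain, Finset.card_sdiff_add_card_eq_card]
  intro e he
  exact Finsupp.mem_support_iff.2 (h e (p.mem_edges_of_chain_ne_zero (Finsupp.mem_support_iff.1 he)))

/-- Inside its support, a chain links any boundary vertex to another one. -/
theorem exists_path_in_chain {P : Sym2 V →₀ ZMod 2} (hP : ∀ e, P e ≠ 0 → e ∈ G.edgeSet)
    {s : V} (hs : boundary P s ≠ 0) :
    ∃ t, t ≠ s ∧ boundary P t ≠ 0 ∧ ∃ p : G.Walk s t, p.IsPath ∧ ∀ e ∈ p.edges, P e ≠ 0 := by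
  classical
  set H : SimpleGraph V := fromEdgeSet {e | P e ≠ 0} with hH
  have hHG : H ≤ G := by
    intro a b hab
    rw [hH, fromEdgeSet_adj] at hab
    exact hP _ hab.1
  have key : ∃ t, t ≠ s ∧ boundary P t ≠ 0 ∧ H.Reachable s t := by
    by_contra! hcon
    -- The boundary sums to zero over the component of `s` in the support, so `s` is not its only
    -- boundary vertex there.
    have h0 : coeffSum {t | H.Reachable s t} (boundary P) = 0 := by
      refine coeffSum_boundary_eq_zero _ _ fun a b hab => ?_
      have hab' : P s(a, b) ≠ 0 := Finsupp.mem_support_iff.1 hab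
      have hadj : H.Adj a b := by
        rw [hH, fromEdgeSet_adj]
        exact ⟨hab', G.ne_of_adj (hP _ hab')⟩
      exact ⟨fun h => h.trans hadj.reachable, fun h => h.trans hadj.symm.reachable⟩
    rw [coeffSum, Finsupp.linearCombination_apply, Finsupp.sum,
      Finset.sum_eq_single s] at h0
    · simp [hs] at h0
    · intro t ht hts
      have := hcon t hts (Finsupp.mem_support_iff.1 ht)
      simp [this]
    · intro h
      exact absurd (Finsupp.mem_support_iff.2 hs) h
  obtain ⟨t, hts, ht, hr⟩ := key
  obtain ⟨p, hp⟩ := hr.exists_isPath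
  refine ⟨t, hts, ht, p.mapLe hHG, (Walk.isPath_mapLe hHG).2 hp, fun e he => ?_⟩
  rw [Walk.edges_mapLe_eq_edges] at he
  have := p.edges_subset_edgeSet he
  rw [hH, edgeSet_fromEdgeSet] at this
  exact this.1

/-- Split off from `P` a path between two boundary vertices and replace it by a shortest path inside
`c`, which is no longer; then induct on the number of edges. Overlaps cancel and only shorten `J`.
-/
theorem IsGeodesicCycle.exists_chain {v : V} {c : G.Walk v v} (hc : G.IsGeodesicCycle c) (n : ℕ)
    (P : Sym2 V →₀ ZMod 2) (hn : P.support.card = n) (hP : ∀ e, P e ≠ 0 → e ∈ G.edgeSet)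
    (hb : ∀ x, boundary P x ≠ 0 → x ∈ c.support) :
    ∃ J : Sym2 V →₀ ZMod 2, (∀ e, J e ≠ 0 → e ∈ c.edges) ∧ boundary J = boundary P ∧
      J.support.card ≤ P.support.card := by
  induction n using Nat.strong_induction_on generalizing P with | _ n ih
  by_cases h0 : boundary P = 0
  · exact ⟨0, by simp, by simp [h0], by simp⟩
  obtain ⟨s, hs⟩ := Finsupp.ne_iff.1 h0
  obtain ⟨t, hts, ht, p, hp, hpP⟩ := exists_path_in_chain hP hs
  have hcard := card_support_add_chain hp.isTrail hpP
  have hpos : 0 < p.length := by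
    rw [Nat.pos_iff_ne_zero]
    intro h
    exact hts (Walk.eq_of_length_eq_zero h).symm
  have hPe : ∀ e, (P + p.chain) e ≠ 0 → P e ≠ 0 := by
    intro e he h
    by_cases hep : e ∈ p.edges
    · exact hpP e hep h
    · simp [h, p.chain_apply_of_notMem hep] at he
  obtain ⟨J, hJ, hJb, hJc⟩ := ih (P + p.chain).support.card (by omega) (P + p.chain) rfl
    (fun e he => hP e (hPe e he)) (by
      intro x hx
      rw [map_add, p.boundary_chain] at hx
      by_cases hxs : x = s
      · exact hb x (hxs ▸ hs)
      by_cases hxt : x = t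
      · exact hb x (hxt ▸ ht)
      refine hb x fun h => hx ?_
      simp [h, Ne.symm hxs, Ne.symm hxt])
  obtain ⟨q, hq, hql, hqc⟩ := hc.2 s (hb s hs) t (hb t ht)
  have hqe : ∀ e ∈ q.edges, e ∈ c.edges := by
    intro e he
    rw [← Walk.mem_edges_toSubgraph] at he ⊢
    exact Subgraph.edgeSet_mono hqc he
  refine ⟨J + q.chain, fun e he => ?_, ?_, ?_⟩
  · by_contra h
    have h1 : J e = 0 := by
      by_contra h'
      exact h (hJ e h')
    have h2 : q.chain e = 0 := q.chain_apply_of_notMem fun h' => h (hqe e h')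
    simp [h1, h2] at he
  · rw [map_add, hJb, map_add, p.boundary_chain, q.boundary_chain, add_assoc, chain_add_self,
      add_zero]
  · have h1 := card_support_add_le J q.chain
    have h2 := q.card_support_chain_le
    have h3 := dist_le p
    omega

/-- At most half of a geodesic cycle is a shortest chain with its boundary. -/
theorem IsGeodesicCycle.card_support_le {v : V} {c : G.Walk v v} (hc : G.IsGeodesicCycle c)
    (J P : Sym2 V →₀ ZMod 2) (hJ : ∀ e, J e ≠ 0 → e ∈ c.edges)
    (hJc : 2 * J.support.card ≤ c.length) (hP : ∀ e, P e ≠ 0 → e ∈ G.edgeSet)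
    (hb : boundary P = boundary J) : J.support.card ≤ P.support.card := by
  obtain ⟨J', hJ', hb', hle⟩ := hc.exists_chain _ P rfl hP fun x hx => by
    by_contra h
    rw [hb] at hx
    exact hx (boundary_apply_eq_zero_of_notMem_support c hJ h)
  refine le_trans ?_ hle
  -- Either `J' = J`, or `J'` is the rest of `c` and contains at least half of it.
  rcases hc.1.chain_eq_zero_or_eq (J + J') (fun e he => by
    by_contra h
    have h1 : J e = 0 := by
      by_contra h'
      exact h (hJ e h')
    have h2 : J' e = 0 := by
      by_contra h'
      exact h (hJ' e h')
    simp [h1, h2] at he) (by rw [map_add, hb', hb, chain_add_self]) with h | h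
  · rw [eq_of_chain_add_eq_zero h]
  · have h1 := card_support_add_le J J'
    rw [h, hc.1.isTrail.card_support_chain] at h1
    omega

end Geodesic

/-! ### Joining boundaries by few short chains -/

section Joins

variable {V : Type u}

/-- The boundaries `x + y` with `x, y ∈ X` of chains in `G` with at most `l / 2` edges. -/
def nearPairs (G : SimpleGraph V) (X : Set V) (l : ℕ) : Set (V →₀ ZMod 2) :=
  {f | ∃ x ∈ X, ∃ y ∈ X, f = Finsupp.single x 1 + Finsupp.single y 1 ∧
    ∃ P : Sym2 V →₀ ZMod 2, (∀ e, P e ≠ 0 → e ∈ G.edgeSet) ∧ boundary P = f ∧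
      2 * P.support.card ≤ l}

variable {G : SimpleGraph V}

theorem card_support_linearCombination_le {ι α : Type*} (Q : ι → α →₀ ZMod 2) {l : ℕ}
    (hQ : ∀ i, 2 * (Q i).support.card ≤ l) (a : ι →₀ ZMod 2) :
    2 * (Finsupp.linearCombination (ZMod 2) Q a).support.card ≤ a.support.card * l := by
  induction a using Finsupp.induction with
  | zero => simp
  | single_add i r a hi hr ih =>
    rw [Finsupp.support_single_add hi hr, Finset.card_cons, map_add]
    have h1 := card_support_add_le (Finsupp.linearCombination (ZMod 2) Q (Finsupp.single i r))
      (Finsupp.linearCombination (ZMod 2) Q a)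
    rw [Finsupp.linearCombination_single, zmod_two_eq_one_of_ne_zero hr, one_smul] at h1
    have h2 := hQ i
    rw [zmod_two_eq_one_of_ne_zero hr, Finsupp.linearCombination_single, one_smul]
    nlinarith

/-- Three elements of the two-element field that sum to zero are all zero or include exactly two
ones. -/
theorem card_support_add_three_le {ι : Type*} [Fintype ι] (a b c : ι →₀ ZMod 2)
    (h : a + b + c = 0) :
    a.support.card + b.support.card + c.support.card ≤ 2 * Fintype.card ι := by
  classical
  have hs : ∀ d : ι →₀ ZMod 2, d.support.card = ∑ i, if d i ≠ 0 then 1 else 0 := by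
    intro d
    rw [Finset.sum_boole, Nat.cast_id]
    congr 1
    ext i
    simp
  rw [hs, hs, hs, ← Finset.sum_add_distrib, ← Finset.sum_add_distrib, mul_comm,
    ← smul_eq_mul, ← Finset.card_univ]
  refine Finset.sum_le_card_nsmul _ _ _ fun i _ => ?_
  have := DFunLike.congr_fun h i
  simp only [Finsupp.add_apply, Finsupp.zero_apply] at this
  revert this
  generalize a i = x
  generalize b i = y
  generalize c i = z
  revert x y z
  decide

/-- Linearly independent sums of pairs from `X` are fewer than the elements of `X`. -/
theorem card_lt_of_linearIndependent_pairs {X : Finset V} {w : ℕ} (hX : X.card ≤ w + 1)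
    {b : Set (V →₀ ZMod 2)} (hb : ∀ f ∈ b, ∃ x ∈ X, ∃ y ∈ X,
      f = Finsupp.single x 1 + Finsupp.single y 1)
    (hli : LinearIndependent (ZMod 2) ((↑) : b → V →₀ ZMod 2)) :
    Finite b ∧ Nat.card b ≤ w := by
  classical
  rcases X.eq_empty_or_nonempty with rfl | ⟨x₀, hx₀⟩
  · have : IsEmpty b := ⟨fun f => by
      obtain ⟨x, hx, -⟩ := hb f f.2
      simp at hx⟩
    exact ⟨inferInstance, by simp⟩
  have hspan : ∀ f ∈ Submodule.span (ZMod 2) b, coeffSum Set.univ f = 0 ∧ ∀ x ∉ X, f x = 0 := by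
    intro f hf
    induction hf using Submodule.span_induction with
    | mem f hf =>
      obtain ⟨x, hx, y, hy, rfl⟩ := hb f hf
      refine ⟨by simp [coeffSum_single, CharTwo.add_self_eq_zero], fun z hz => ?_⟩
      have h1 : x ≠ z := fun h => hz (h ▸ hx)
      have h2 : y ≠ z := fun h => hz (h ▸ hy)
      simp [h1, h2]
    | zero => simp
    | add f g _ _ hf hg =>
      exact ⟨by rw [map_add, hf.1, hg.1, add_zero], fun z hz => by
        rw [Finsupp.add_apply, hf.2 z hz, hg.2 z hz, add_zero]⟩
    | smul r f _ hf =>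
      exact ⟨by rw [map_smul, hf.1, smul_zero], fun z hz => by
        rw [Finsupp.smul_apply, hf.2 z hz, smul_zero]⟩
  -- Dropping the coordinate at `x₀` is injective on the span, because coefficients there sum to
  -- zero; this gives the bound `X.card - 1`.
  let ρ : (V →₀ ZMod 2) →ₗ[ZMod 2] ({x // x ∈ X.erase x₀} → ZMod 2) :=
    LinearMap.pi fun x => Finsupp.lapply x.1
  have hker : ∀ f ∈ Submodule.span (ZMod 2) b, ρ f = 0 → f = 0 := by
    intro f hf hρ
    obtain ⟨hsum, hoff⟩ := hspan f hf
    have hz : ∀ x, x ≠ x₀ → f x = 0 := by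
      intro x hx
      by_cases hxX : x ∈ X
      · exact congr_fun hρ ⟨x, Finset.mem_erase.2 ⟨hx, hxX⟩⟩
      · exact hoff x hxX
    have hf0 : f = Finsupp.single x₀ (f x₀) := by
      ext x
      by_cases hx : x = x₀
      · subst hx; simp
      · simp [hz x hx, Ne.symm hx]
    rw [hf0, coeffSum_single] at hsum
    rw [hf0]
    simpa using hsum
  have hli' : LinearIndependent (ZMod 2) (ρ ∘ ((↑) : b → V →₀ ZMod 2)) := by
    refine hli.map_injOn ρ ?_
    rw [Subtype.range_coe]
    intro f hf g hg hfg
    have := hker (f - g) (Submodule.sub_mem _ hf hg) (by rw [map_sub, hfg, sub_self])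
    exact sub_eq_zero.1 this
  have : Finite b := hli'.finite
  have : Fintype b := Fintype.ofFinite b
  refine ⟨inferInstance, ?_⟩
  rw [Nat.card_eq_fintype_card]
  have : Fintype.card b ≤ _ := hli'.fintype_card_le_finrank
  rw [Module.finrank_fintype_fun_eq_card, Fintype.card_coe, Finset.card_erase_of_mem hx₀] at this
  omega

/-- Expand each `S i` in a basis of near pairs. Each of the at most `w` basis elements is used at
most twice, at a cost of at most `l / 2` each time. -/
theorem exists_three_joins {X : Finset V} {w l : ℕ} (hX : X.card ≤ w + 1)
    {S : Fin 3 → V →₀ ZMod 2} (hS : ∀ i, S i ∈ Submodule.span (ZMod 2) (nearPairs G X l))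
    (h0 : S 0 + S 1 + S 2 = 0) :
    ∃ P : Fin 3 → Sym2 V →₀ ZMod 2, (∀ i e, P i e ≠ 0 → e ∈ G.edgeSet) ∧
      (∀ i, boundary (P i) = S i) ∧
      (P 0).support.card + (P 1).support.card + (P 2).support.card ≤ w * l := by
  classical
  obtain ⟨b, hbs, hspan, hli⟩ := exists_linearIndependent (ZMod 2) (nearPairs G X l)
  obtain ⟨hfin, hcard⟩ := card_lt_of_linearIndependent_pairs hX (fun f hf => by
    obtain ⟨x, hx, y, hy, h, -⟩ := hbs hf
    exact ⟨x, hx, y, hy, h⟩) hli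
  have : Fintype b := Fintype.ofFinite b
  rw [Nat.card_eq_fintype_card] at hcard
  have hQ : ∀ f : b, ∃ P : Sym2 V →₀ ZMod 2, (∀ e, P e ≠ 0 → e ∈ G.edgeSet) ∧ boundary P = f ∧
      2 * P.support.card ≤ l := fun f => by
    obtain ⟨x, hx, y, hy, -, h⟩ := hbs f.2
    exact h
  choose Q hQG hQb hQl using hQ
  have ha : ∀ i, ∃ a : b →₀ ZMod 2, Finsupp.linearCombination (ZMod 2) ((↑) : b → _) a = S i :=
    fun i => by
      have := hS i
      rw [← hspan, ← Subtype.range_coe (s := b), Finsupp.mem_span_range_iff_exists_finsupp] at this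
      exact this
  choose a ha using ha
  have hsum : a 0 + a 1 + a 2 = 0 := by
    apply hli
    rw [map_add, map_add, ha, ha, ha, h0, map_zero]
  refine ⟨fun i => Finsupp.linearCombination (ZMod 2) Q (a i), fun i e he => ?_, fun i => ?_, ?_⟩
  · simp only [Finsupp.linearCombination_apply, Finsupp.sum, Finsupp.finsetSum_apply] at he
    obtain ⟨f, -, hf⟩ := Finset.exists_ne_zero_of_sum_ne_zero he
    refine hQG f e fun h => hf ?_
    rw [Finsupp.smul_apply, h, smul_zero]
  · rw [← LinearMap.comp_apply, ← ha i]
    congr 1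
    ext f
    simp [hQb]
  · have h1 := fun i => card_support_linearCombination_le Q hQl (a i)
    have h2 := card_support_add_three_le _ _ _ hsum
    have h3 := h1 0
    have h4 := h1 1
    have h5 := h1 2
    have h6 : ((a 0).support.card + (a 1).support.card + (a 2).support.card) * l ≤ 2 * w * l :=
      Nat.mul_le_mul_right _ (by omega)
    dsimp only
    nlinarith

end Joins

/-! ### Edge sets that split at a set of vertices -/

section Splitting

variable {V : Type u}

/-- An edge set is splitting at `X` if, at every vertex outside `X`, it contains all or none of
the edges of `G`. -/
def IsSplitting (G : SimpleGraph V) (X : Set V) (A : Set (Sym2 V)) : Prop :=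
  ∀ v ∉ X, ∀ x y, G.Adj v x → G.Adj v y → s(v, x) ∈ A → s(v, y) ∈ A

variable {G : SimpleGraph V} {X : Set V} {A B : Set (Sym2 V)}

theorem IsSplitting.union (hA : G.IsSplitting X A) (hB : G.IsSplitting X B) :
    G.IsSplitting X (A ∪ B) := fun v hv x y hx hy h =>
  h.imp (hA v hv x y hx hy) (hB v hv x y hx hy)

theorem IsSplitting.compl (hA : G.IsSplitting X A) : G.IsSplitting X Aᶜ :=
  fun v hv x y hx hy h h' => h (hA v hv y x hy hx h')

theorem IsSplitting.diff (hA : G.IsSplitting X A) (hB : G.IsSplitting X B) :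
    G.IsSplitting X (A \ B) := fun v hv x y hx hy h =>
  ⟨hA v hv x y hx hy h.1, hB.compl v hv x y hx hy h.2⟩

theorem isSplitting_empty : G.IsSplitting X ∅ := fun _ _ _ _ _ _ h => h.elim

theorem isSplitting_singleton {a b : V} (ha : a ∈ X) (hb : b ∈ X) :
    G.IsSplitting X {s(a, b)} := by
  intro v hv x y _ _ h
  rw [Set.mem_singleton_iff, Sym2.eq_iff] at h
  rcases h with ⟨rfl, -⟩ | ⟨rfl, -⟩
  · exact absurd ha hv
  · exact absurd hb hv

/-- At a vertex outside `X` the restriction keeps all edges of `z` or none. -/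
theorem IsSplitting.boundary_eq_zero (hA : G.IsSplitting X A) {z : Sym2 V →₀ ZMod 2}
    (hz : ∀ e, z e ≠ 0 → e ∈ G.edgeSet) (hb : boundary z = 0) {v : V} (hv : v ∉ X) :
    boundary (chainRestrict A z) v = 0 := by
  by_cases h : ∃ x, G.Adj v x ∧ s(v, x) ∈ A
  · obtain ⟨x, hx, hxA⟩ := h
    refine Eq.trans ?_ (DFunLike.congr_fun hb v)
    refine boundary_apply_congr fun y => ?_
    rw [chainRestrict_apply]
    split_ifs with hy
    · rfl
    · by_contra hne
      exact hy (hA v hv x y hx (hz _ (Ne.symm hne)) hxA)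
  · refine boundary_apply_eq_zero _ _ fun y => ?_
    rw [chainRestrict_apply]
    split_ifs with hy
    · by_contra hne
      exact h ⟨y, hz _ hne, hy⟩
    · rfl

/-- Pair every vertex of the support with a fixed `x₀`; the copies of `x₀` cancel because the
coefficients sum to zero. -/
theorem mem_span_pairs {Y : Set V} {f : V →₀ ZMod 2} (hY : ∀ x, f x ≠ 0 → x ∈ Y)
    (h0 : coeffSum Set.univ f = 0) :
    f ∈ Submodule.span (ZMod 2)
      {g | ∃ x ∈ Y, ∃ y ∈ Y, g = Finsupp.single x (1 : ZMod 2) + Finsupp.single y 1} := by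
  classical
  by_cases hf : f = 0
  · rw [hf]; exact Submodule.zero_mem _
  obtain ⟨x₀, hx₀⟩ := Finsupp.ne_iff.1 hf
  have h1 : f = f.sum fun x r => r • (Finsupp.single x (1 : ZMod 2) + Finsupp.single x₀ 1) := by
    have h2 : (f.sum fun x r => r • Finsupp.single x₀ (1 : ZMod 2)) = 0 := by
      have h3 : f.sum (fun _ r => r) = 0 := by
        simpa [coeffSum, Finsupp.linearCombination_apply] using h0
      rw [Finsupp.sum] at h3 ⊢
      rw [← Finset.sum_smul, h3, zero_smul]
    simp only [smul_add]
    rw [Finsupp.sum_add, h2, add_zero]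
    simp
  rw [h1]
  refine Submodule.sum_mem _ fun x hx => Submodule.smul_mem _ _ (Submodule.subset_span ?_)
  exact ⟨x, hY x (Finsupp.mem_support_iff.1 hx), x₀, hY x₀ hx₀, rfl⟩

/-- Take the shorter of the two arcs of `F` between `x` and `y`. -/
theorem exists_half_chain {u : V} (F : G.Walk u u) {x y : V} (hx : x ∈ F.support)
    (hy : y ∈ F.support) : ∃ P : Sym2 V →₀ ZMod 2, (∀ e, P e ≠ 0 → e ∈ G.edgeSet) ∧
      boundary P = Finsupp.single x 1 + Finsupp.single y 1 ∧ 2 * P.support.card ≤ F.length := by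
  classical
  have hy' : y ∈ (F.rotate x hx).support := by
    rwa [Walk.mem_support_rotate_iff]
  set p := (F.rotate x hx).takeUntil y hy'
  set q := (F.rotate x hx).dropUntil y hy'
  have hlen : p.length + q.length = F.length := by
    rw [← Walk.length_append, Walk.take_spec, Walk.length_rotate]
  have hG : ∀ {a b : V} (r : G.Walk a b) e, r.chain e ≠ 0 → e ∈ G.edgeSet := fun r e he =>
    r.edges_subset_edgeSet (r.mem_edges_of_chain_ne_zero he)
  have h1 := p.card_support_chain_le
  have h2 := q.card_support_chain_le
  rcases le_total p.length q.length with h | h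
  · exact ⟨p.chain, hG p, p.boundary_chain, by omega⟩
  · exact ⟨q.chain, hG q, by rw [q.boundary_chain, add_comm], by omega⟩

/-- By linearity one short cycle `F` suffices: the boundary of its restriction lies in `X` and on
`F`, and any two vertices of `F` are joined by at most half of it. -/
theorem IsSplitting.boundary_mem_span (hA : G.IsSplitting X A) {l : ℕ} {z : Sym2 V →₀ ZMod 2}
    (hz : z ∈ Submodule.span (ZMod 2)
      {z | ∃ (u : V) (F : G.Walk u u), F.IsCycle ∧ F.length ≤ l ∧ z = F.chain}) :
    boundary (chainRestrict A z) ∈ Submodule.span (ZMod 2) (nearPairs G X l) := by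
  suffices h : Submodule.span (ZMod 2)
      {z | ∃ (u : V) (F : G.Walk u u), F.IsCycle ∧ F.length ≤ l ∧ z = F.chain} ≤
      (Submodule.span (ZMod 2) (nearPairs G X l)).comap (boundary.comp (chainRestrict A)) from h hz
  rw [Submodule.span_le]
  rintro _ ⟨u, F, hF, hl, rfl⟩
  have hmem : boundary (chainRestrict A F.chain) ∈ Submodule.span (ZMod 2)
      {g | ∃ x ∈ X ∩ {x | x ∈ F.support}, ∃ y ∈ X ∩ {x | x ∈ F.support},
        g = Finsupp.single x (1 : ZMod 2) + Finsupp.single y 1} := by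
    refine mem_span_pairs (fun x hx => ⟨?_, ?_⟩) (coeffSum_univ_boundary _)
    · by_contra h
      refine hx (hA.boundary_eq_zero (fun e he => F.edges_subset_edgeSet
        (F.mem_edges_of_chain_ne_zero he)) ?_ h)
      rw [F.boundary_chain, chain_add_self]
    · by_contra h
      refine hx (boundary_apply_eq_zero_of_notMem_support F (fun e he => ?_) h)
      refine F.mem_edges_of_chain_ne_zero fun h0 => he ?_
      rw [chainRestrict_apply, h0, ite_self]
  refine Submodule.span_mono ?_ hmem
  rintro _ ⟨x, hx, y, hy, rfl⟩
  obtain ⟨P, hP, hPb, hPl⟩ := exists_half_chain F hx.2 hy.2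
  exact ⟨x, hx.1, y, hy.1, rfl, P, hP, hPb, hPl.trans hl⟩

/-! ### Counting the edges of a cycle in splitting sets -/

open Classical in
theorem support_chainRestrict (A : Set (Sym2 V)) (c : Sym2 V →₀ ZMod 2) :
    (chainRestrict A c).support = c.support.filter (· ∈ A) := by
  ext e
  simp [chainRestrict_apply, and_comm]

/-- The number of edges of a walk in an edge set. -/
noncomputable def Walk.edgeCount {u v : V} (c : G.Walk u v) (A : Set (Sym2 V)) : ℕ :=
  (chainRestrict A c.chain).support.card

theorem Walk.edgeCount_mono {u v : V} (c : G.Walk u v) (h : ∀ e ∈ c.edges, e ∈ A → e ∈ B) :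
    c.edgeCount A ≤ c.edgeCount B := by
  classical
  rw [Walk.edgeCount, Walk.edgeCount, support_chainRestrict, support_chainRestrict]
  refine Finset.card_le_card fun e he => ?_
  rw [Finset.mem_filter] at he ⊢
  exact ⟨he.1, h e (c.mem_edges_of_chain_ne_zero (Finsupp.mem_support_iff.1 he.1)) he.2⟩

theorem Walk.edgeCount_add_compl {u v : V} {c : G.Walk u v} (hc : c.IsTrail)
    (A : Set (Sym2 V)) : c.edgeCount A + c.edgeCount Aᶜ = c.length := by
  classical
  rw [Walk.edgeCount, Walk.edgeCount, support_chainRestrict, support_chainRestrict,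
    ← hc.card_support_chain]
  simp only [Set.mem_compl_iff]
  exact Finset.card_filter_add_card_filter_not (s := c.chain.support) (· ∈ A)

theorem chainRestrict_add_chainRestrict_add (hAB : Disjoint A B) (z : Sym2 V →₀ ZMod 2) :
    chainRestrict A z + chainRestrict B z + chainRestrict (A ∪ B)ᶜ z = z := by
  ext e
  simp only [Finsupp.add_apply, chainRestrict_apply, Set.mem_compl_iff, Set.mem_union]
  by_cases hA : e ∈ A
  · have : e ∉ B := fun hB => Set.disjoint_left.1 hAB hA hB
    simp [hA, this]
  · by_cases hB : e ∈ B <;> simp [hA, hB]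

/-- Splitting sets containing at most half of a geodesic cycle form an ideal. -/
theorem IsGeodesicCycle.edgeCount_union_le {v : V} {c : G.Walk v v} (hc : G.IsGeodesicCycle c)
    {X : Finset V} {w l : ℕ} (hX : X.card ≤ w + 1) (hwl : w * l < c.length)
    (hcl : c.chain ∈ Submodule.span (ZMod 2)
      {z | ∃ (u : V) (F : G.Walk u u), F.IsCycle ∧ F.length ≤ l ∧ z = F.chain})
    (hA : G.IsSplitting X A) (hB : G.IsSplitting X B) (hAB : Disjoint A B)
    (hAc : 2 * c.edgeCount A ≤ c.length) (hBc : 2 * c.edgeCount B ≤ c.length) :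
    2 * c.edgeCount (A ∪ B) ≤ c.length := by
  by_contra! hcon
  have hcompl := Walk.edgeCount_add_compl hc.1.isTrail (A ∪ B)
  -- The third piece is light because the union is not.
  let Z : Fin 3 → Set (Sym2 V) := ![A, B, (A ∪ B)ᶜ]
  have hZ : ∀ i, G.IsSplitting X (Z i) := by
    intro i
    fin_cases i
    exacts [hA, hB, (hA.union hB).compl]
  have hZc : ∀ i, 2 * c.edgeCount (Z i) ≤ c.length := by
    intro i
    fin_cases i
    · exact hAc
    · exact hBc
    · change 2 * c.edgeCount (A ∪ B)ᶜ ≤ _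
      omega
  have hsum := chainRestrict_add_chainRestrict_add hAB c.chain
  obtain ⟨P, hPG, hPb, hPle⟩ := exists_three_joins hX
    (fun i => (hZ i).boundary_mem_span hcl) (by
      rw [← map_add, ← map_add]
      change boundary (chainRestrict A c.chain + chainRestrict B c.chain +
        chainRestrict (A ∪ B)ᶜ c.chain) = 0
      rw [hsum, c.boundary_chain, chain_add_self])
  have hle : ∀ i, c.edgeCount (Z i) ≤ (P i).support.card := fun i =>
    hc.card_support_le _ _ (fun e he => c.mem_edges_of_chain_ne_zero fun h0 => he (by
      rw [chainRestrict_apply, h0, ite_self])) (hZc i) (hPG i) (hPb i)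
  have h0 : c.edgeCount A ≤ _ := hle 0
  have h1 : c.edgeCount B ≤ _ := hle 1
  have h2 : c.edgeCount (A ∪ B)ᶜ ≤ _ := hle 2
  have h3 := card_support_add_le (chainRestrict A c.chain + chainRestrict B c.chain)
    (chainRestrict (A ∪ B)ᶜ c.chain)
  have h4 := card_support_add_le (chainRestrict A c.chain) (chainRestrict B c.chain)
  rw [hsum, hc.1.isTrail.card_support_chain] at h3
  simp only [Walk.edgeCount] at h0 h1 h2
  omega

/-- A geodesic cycle is not covered by splitting sets that contain at most half of it. -/
theorem IsGeodesicCycle.exists_edge_forall_splitting {v : V} {c : G.Walk v v}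
    (hc : G.IsGeodesicCycle c) {X : Finset V} {w l : ℕ} (hX : X.card ≤ w + 1)
    (hwl : w * l < c.length)
    (hcl : c.chain ∈ Submodule.span (ZMod 2)
      {z | ∃ (u : V) (F : G.Walk u u), F.IsCycle ∧ F.length ≤ l ∧ z = F.chain}) :
    ∃ e ∈ c.edges, ∀ A, G.IsSplitting X A → e ∈ A → c.length < 2 * c.edgeCount A := by
  classical
  by_contra! hcon
  have key : ∀ s : Finset (Sym2 V), (∀ e ∈ s, e ∈ c.edges) →
      ∃ U, G.IsSplitting X U ∧ 2 * c.edgeCount U ≤ c.length ∧ ∀ e ∈ s, e ∈ U := by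
    intro s
    induction s using Finset.induction with
    | empty => exact fun _ => ⟨∅, isSplitting_empty, by simp [Walk.edgeCount, support_chainRestrict],
        by simp⟩
    | insert e s _ ih =>
      intro hs
      obtain ⟨U, hU, hUc, hUs⟩ := ih fun e he => hs e (Finset.mem_insert_of_mem he)
      obtain ⟨A, hA, heA, hAc⟩ := hcon e (hs e (Finset.mem_insert_self e s))
      -- Removing `U` from `A` keeps it splitting and light, and makes the union disjoint.
      refine ⟨U ∪ A \ U, hU.union (hA.diff hU), ?_, fun f hf => ?_⟩
      · refine hc.edgeCount_union_le hX hwl hcl hU (hA.diff hU) Set.disjoint_sdiff_right hUc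
          (le_trans ?_ hAc)
        exact Nat.mul_le_mul_left 2 (c.edgeCount_mono fun _ _ h => h.1)
      · rw [Set.union_sdiff_self]
        rcases Finset.mem_insert.1 hf with rfl | hf
        · exact Or.inr heA
        · exact Or.inl (hUs f hf)
  obtain ⟨U, -, hUc, hU⟩ := key c.edges.toFinset fun e he => List.mem_toFinset.1 he
  have h1 : c.edgeCount Set.univ ≤ c.edgeCount U :=
    c.edgeCount_mono fun e he _ => hU e (List.mem_toFinset.2 he)
  have h2 : c.edgeCount Set.univ = c.length := by
    rw [← hc.1.isTrail.card_support_chain, Walk.edgeCount, support_chainRestrict]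
    simp
  have h3 := hc.1.three_le_length
  omega

/-! ### From the edge space to finite chains -/

theorem Walk.IsTrail.edgeVector_eq {u : V} {c : G.Walk u u} (hc : c.IsTrail) :
    G.edgeVector c = fun e : G.edgeSet => c.chain e := by
  classical
  ext e
  rw [edgeVector, Set.indicator_apply]
  by_cases he : (e : Sym2 V) ∈ c.edges
  · simp [he, c.chain_apply_of_mem hc he]
  · simp [he, c.chain_apply_of_notMem he]

/-- Restricting chains to `G.edgeSet` maps short cycles to their edge vectors, and it loses nothing
on the span because chains of cycles vanish off `G.edgeSet`. -/
theorem Walk.IsCycle.chain_mem_span {u : V} {c : G.Walk u u} (hc : c.IsCycle) {l : ℕ}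
    (hl : G.shortCycleSpan l = G.cycleSpace) : c.chain ∈ Submodule.span (ZMod 2)
      {z | ∃ (u : V) (F : G.Walk u u), F.IsCycle ∧ F.length ≤ l ∧ z = F.chain} := by
  let ι : (Sym2 V →₀ ZMod 2) →ₗ[ZMod 2] (G.edgeSet → ZMod 2) :=
    LinearMap.pi fun e => Finsupp.lapply e.1
  have hι : ∀ {u : V} {c : G.Walk u u}, c.IsCycle → ι c.chain = G.edgeVector c := fun hc =>
    hc.isTrail.edgeVector_eq.symm
  set S := {z | ∃ (u : V) (F : G.Walk u u), F.IsCycle ∧ F.length ≤ l ∧ z = F.chain} with hS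
  have hmem : G.edgeVector c ∈ G.shortCycleSpan l := by
    rw [hl]
    exact Submodule.subset_span ⟨u, c, hc, rfl⟩
  have himage : {x | ∃ (v : V) (c : G.Walk v v), c.IsCycle ∧ c.length ≤ l ∧ x = G.edgeVector c} =
      ι '' S := by
    ext x
    constructor
    · rintro ⟨v, c, hc, hl, rfl⟩
      exact ⟨c.chain, ⟨v, c, hc, hl, rfl⟩, hι hc⟩
    · rintro ⟨_, ⟨v, c, hc, hl, rfl⟩, rfl⟩
      exact ⟨v, c, hc, hl, hι hc⟩
  rw [shortCycleSpan, himage, Submodule.span_image] at hmem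
  obtain ⟨y, hy, hyc⟩ := hmem
  rw [← hι hc] at hyc
  have hsupp : ∀ y ∈ Submodule.span (ZMod 2) S, ∀ e ∉ G.edgeSet, y e = 0 := by
    intro y hy e he
    induction hy using Submodule.span_induction with
    | mem y hy =>
      obtain ⟨v, F, -, -, rfl⟩ := hy
      exact F.chain_apply_of_notMem fun h => he (F.edges_subset_edgeSet h)
    | zero => rfl
    | add y z _ _ hy hz => rw [Finsupp.add_apply, hy, hz, add_zero]
    | smul r y _ hy => rw [Finsupp.smul_apply, hy, smul_zero]
  have : c.chain = y := by
    ext e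
    by_cases he : e ∈ G.edgeSet
    · exact (congr_fun hyc ⟨e, he⟩).symm
    · rw [hsupp y hy e he, c.chain_apply_of_notMem fun h => he (c.edges_subset_edgeSet h)]
  rw [this]
  exact hy

end Splitting

/-! ### Branches of a tree -/

section Branches

variable {V : Type u} {T : SimpleGraph V}

/-- The vertices that can be reached from `t'` by a path avoiding `t`. -/
def branch (T : SimpleGraph V) (t t' : V) : Set V :=
  {s | ∃ p : T.Walk t' s, p.IsPath ∧ t ∉ p.support}

theorem mem_branch_of_walk {t t' s : V} (p : T.Walk t' s) (hp : t ∉ p.support) :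
    s ∈ T.branch t t' := by
  classical
  exact ⟨p.bypass, p.bypass_isPath, fun h => hp (p.support_bypass_subset_support h)⟩

theorem Connected.exists_mem_branch (hT : T.Connected) {t s : V} (hst : s ≠ t) :
    ∃ t', T.Adj t t' ∧ s ∈ T.branch t t' := by
  obtain ⟨p, hp⟩ := (hT t s).exists_isPath
  cases p with
  | nil => exact absurd rfl hst
  | cons h p =>
    rw [Walk.cons_isPath_iff] at hp
    exact ⟨_, h, p, hp⟩

theorem mem_support_of_mem_branch {t t' s s' : V} (hs : s ∈ T.branch t t')
    (hs' : s' ∉ T.branch t t') (q : T.Walk s s') : t ∈ q.support := by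
  obtain ⟨p, -, hp⟩ := hs
  by_contra hq
  refine hs' (mem_branch_of_walk (p.append q) ?_)
  rw [Walk.mem_support_append_iff, not_or]
  exact ⟨hp, hq⟩

theorem IsAcyclic.eq_of_mem_branch (hT : T.IsAcyclic) {t t' t'' s : V} (h' : T.Adj t t')
    (h'' : T.Adj t t'') (hs' : s ∈ T.branch t t') (hs'' : s ∈ T.branch t t'') : t' = t'' := by
  obtain ⟨p, hp, htp⟩ := hs'
  obtain ⟨q, hq, htq⟩ := hs''
  have := (hT.subsingleton_path _ _).elim ⟨Walk.cons h' p, (Walk.cons_isPath_iff _ _).2 ⟨hp, htp⟩⟩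
    ⟨Walk.cons h'' q, (Walk.cons_isPath_iff _ _).2 ⟨hq, htq⟩⟩
  exact (Walk.cons.inj (congr_arg Subtype.val this)).1

theorem IsAcyclic.notMem_branch_swap (hT : T.IsAcyclic) {t t' s : V} (h : T.Adj t t')
    (hs : s ∈ T.branch t t') : s ∉ T.branch t' t := by
  rintro ⟨q, hq, htq⟩
  obtain ⟨p, hp, htp⟩ := hs
  have := (hT.subsingleton_path _ _).elim ⟨Walk.cons h p, (Walk.cons_isPath_iff _ _).2 ⟨hp, htp⟩⟩ ⟨q, hq⟩
  have hpq : Walk.cons h p = q := congr_arg Subtype.val this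
  rw [← hpq] at htq
  exact htq (by simp)

/-- A path from `t''` that avoids `t'` but meets `t` would put `t` in two different branches at
`t'`. -/
theorem IsAcyclic.branch_subset_branch (hT : T.IsAcyclic) {t t' t'' : V} (h : T.Adj t t')
    (h' : T.Adj t' t'') (hne : t'' ≠ t) : T.branch t' t'' ⊆ T.branch t t' := by
  rintro s ⟨p, hp, htp⟩
  refine mem_branch_of_walk (Walk.cons h' p) ?_
  rw [Walk.support_cons, List.mem_cons, not_or]
  refine ⟨T.ne_of_adj h, fun ht => hne ?_⟩
  classical
  refine (hT.eq_of_mem_branch h.symm h' (s := t) ?_ ?_).symm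
  · exact mem_branch_of_walk Walk.nil (by simpa using (T.ne_of_adj h).symm)
  · exact mem_branch_of_walk (p.takeUntil t ht) fun h =>
      htp (p.support_takeUntil_subset_support ht h)

theorem IsAcyclic.dist_eq_length (hT : T.IsAcyclic) {u v : V} {p : T.Walk u v} (hp : p.IsPath) :
    T.dist u v = p.length := by
  obtain ⟨q, hq, hql⟩ := p.reachable.exists_path_of_dist
  rw [← hql]
  exact congr_arg (fun r : T.Path u v => r.1.length) ((hT.subsingleton_path _ _).elim ⟨q, hq⟩ ⟨p, hp⟩)

theorem IsAcyclic.dist_of_mem_branch (hT : T.IsAcyclic) {t t' s : V} (h : T.Adj t t')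
    (hs : s ∈ T.branch t t') : T.dist t s = T.dist t' s + 1 := by
  obtain ⟨p, hp, htp⟩ := hs
  rw [hT.dist_eq_length hp, hT.dist_eq_length ((Walk.cons_isPath_iff h p).2 ⟨hp, htp⟩),
    Walk.length_cons]

end Branches

/-! ### Tree-decompositions of graphs with a geodesic cycle -/

namespace TreeDecomposition

variable {V : Type u} {G : SimpleGraph V} (D : G.TreeDecomposition)

/-- The vertices outside the part at `t` that lie in parts in the branch at `t` towards `t'`. -/
def branchVerts (t t' : D.node) : Set V :=
  {v | v ∉ D.part t ∧ ∃ s ∈ D.tree.branch t t', v ∈ D.part s}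

/-- The edges with an end in `branchVerts`. -/
def branchEdges (t t' : D.node) : Set (Sym2 V) :=
  {e | ∃ v ∈ e, v ∈ D.branchVerts t t'}

variable {D} {t t' : D.node}

/-- A tree path leaving the branch passes through `t`, so (T3) would put `v` in the part at `t`. -/
theorem mem_branch_of_mem_branchVerts {v : V} (hv : v ∈ D.branchVerts t t') {s : D.node}
    (hs : v ∈ D.part s) : s ∈ D.tree.branch t t' := by
  obtain ⟨hvt, s', hs', hvs'⟩ := hv
  by_contra h
  obtain ⟨p, hp⟩ := (D.isTree.connected s' s).exists_isPath
  exact hvt (D.part_inter_part_subset _ _ _ p hp (mem_support_of_mem_branch hs' h p) ⟨hvs', hs⟩)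

variable (D) in
-- A vertex outside the part at `t` with a neighbour in `branchVerts` shares a part with it, hence
-- is itself in `branchVerts`.
theorem isSplitting_branchEdges (t t' : D.node) :
    G.IsSplitting (D.part t) (D.branchEdges t t') := by
  intro v hv x y hx hy h
  suffices hvb : v ∈ D.branchVerts t t' from ⟨v, Sym2.mem_mk_left _ _, hvb⟩
  obtain ⟨z, hz, hzb⟩ := h
  rcases Sym2.mem_iff.1 hz with rfl | rfl
  · exact hzb
  · obtain ⟨s, hvs, hzs⟩ := D.exists_edge_mem_part v z hx
    exact ⟨hv, s, mem_branch_of_mem_branchVerts hzb hzs, hvs⟩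

theorem disjoint_branchEdges (h : D.tree.Adj t t') {e : Sym2 V} (he : e ∈ G.edgeSet)
    (h1 : e ∈ D.branchEdges t t') (h2 : e ∈ D.branchEdges t' t) : False := by
  obtain ⟨a, ha, hab⟩ := h1
  obtain ⟨b, hb, hbb⟩ := h2
  have : ∃ s, a ∈ D.part s ∧ b ∈ D.part s := by
    by_cases hne : a = b
    · subst hne
      obtain ⟨s, hs⟩ := D.exists_mem_part a
      exact ⟨s, hs, hs⟩
    · have heq := (Sym2.mem_and_mem_iff hne).1 ⟨ha, hb⟩
      rw [heq] at he
      exact D.exists_edge_mem_part a b he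
  obtain ⟨s, has, hbs⟩ := this
  exact D.isTree.isAcyclic.notMem_branch_swap h (mem_branch_of_mem_branchVerts hab has)
    (mem_branch_of_mem_branchVerts hbb hbs)

variable (D) in
/-- If all parts are small, every node has a branch with more than half of a geodesic cycle. -/
theorem exists_heavy_branch {v : V} {c : G.Walk v v} (hc : G.IsGeodesicCycle c)
    {w l : ℕ} (hw : ∀ t, (D.part t).encard ≤ w + 1) (hwl : w * l < c.length)
    (hcl : c.chain ∈ Submodule.span (ZMod 2)
      {z | ∃ (u : V) (F : G.Walk u u), F.IsCycle ∧ F.length ≤ l ∧ z = F.chain}) (t : D.node) :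
    ∃ t', D.tree.Adj t t' ∧ c.length < 2 * c.edgeCount (D.branchEdges t t') := by
  classical
  have hfin : (D.part t).Finite := Set.finite_of_encard_le_coe (k := w + 1) (by simpa using hw t)
  have hX : hfin.toFinset.card ≤ w + 1 := by
    have := hw t
    rw [hfin.encard_eq_coe_toFinset_card] at this
    exact_mod_cast this
  obtain ⟨e, he, hA⟩ := hc.exists_edge_forall_splitting hX hwl hcl
  rw [hfin.coe_toFinset] at hA
  -- An edge inside the part is by itself a splitting set, and a single edge is at most half of a
  -- cycle.
  have hout : ∃ x ∈ e, x ∉ D.part t := by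
    by_contra! hin
    induction e with | _ a b
    have h1 := hA _ (isSplitting_singleton (hin a (Sym2.mem_mk_left _ _))
      (hin b (Sym2.mem_mk_right _ _))) rfl
    have h2 : c.edgeCount {s(a, b)} ≤ 1 := by
      refine (Finset.card_le_card (t := {s(a, b)}) fun f hf => ?_).trans
        (Finset.card_singleton _).le
      by_contra hne
      rw [Finset.mem_singleton] at hne
      rw [Finsupp.mem_support_iff, chainRestrict_apply, Set.mem_singleton_iff, if_neg hne] at hf
      exact hf rfl
    have h3 := hc.1.three_le_length
    omega
  obtain ⟨x, hxe, hxt⟩ := hout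
  obtain ⟨s, hs⟩ := D.exists_mem_part x
  obtain ⟨t', htt', hst'⟩ := D.isTree.connected.exists_mem_branch (t := t) (s := s)
    (by rintro rfl; exact hxt hs)
  exact ⟨t', htt', hA _ (D.isSplitting_branchEdges t t') ⟨x, hxe, hxt, s, hst', hs⟩⟩

variable (D) in
theorem length_le_of_isGeodesicCycle {v : V} {c : G.Walk v v} (hc : G.IsGeodesicCycle c)
    {w l : ℕ} (hw : ∀ t, (D.part t).encard ≤ w + 1)
    (hcl : c.chain ∈ Submodule.span (ZMod 2)
      {z | ∃ (u : V) (F : G.Walk u u), F.IsCycle ∧ F.length ≤ l ∧ z = F.chain}) :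
    c.length ≤ w * l := by
  classical
  by_contra! hwl
  have hheavy := D.exists_heavy_branch hc hw hwl hcl
  have hT := D.isTree.isAcyclic
  choose σ hσ using D.exists_mem_part
  -- The tree may be infinite, so termination is measured on `c`: the total distance from `t` to the
  -- chosen nodes of those vertices of `c` whose nodes lie in the branch. Each move into a heavy
  -- branch lowers it.
  let m : D.node → D.node → ℕ := fun t t' =>
    ∑ x ∈ c.support.toFinset, if σ x ∈ D.tree.branch t t' then D.tree.dist t (σ x) else 0
  have hno : ∀ n t t', D.tree.Adj t t' → m t t' = n →
      ¬ c.length < 2 * c.edgeCount (D.branchEdges t t') := by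
    intro n
    induction n using Nat.strong_induction_on with | _ n ih
    intro t t' htt' hm hbig
    obtain ⟨t'', ht'', hbig'⟩ := hheavy t'
    have hne : t'' ≠ t := by
      rintro rfl
      -- The two opposite branches at a tree edge share no edge of `G`, so they cannot both hold
      -- more than half of `c`.
      have h1 : c.edgeCount (D.branchEdges t' t'') ≤ c.edgeCount (D.branchEdges t'' t')ᶜ :=
        c.edgeCount_mono fun e he h h' =>
          disjoint_branchEdges htt' (c.edges_subset_edgeSet he) h' h
      have h2 := Walk.edgeCount_add_compl hc.1.isTrail (D.branchEdges t'' t')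
      omega
    refine ih (m t' t'') ?_ t' t'' ht'' rfl hbig'
    rw [← hm]
    have hstep : ∀ x, σ x ∈ D.tree.branch t' t'' → σ x ∈ D.tree.branch t t' ∧
        D.tree.dist t' (σ x) < D.tree.dist t (σ x) := by
      intro x hx
      have hx' := hT.branch_subset_branch htt' ht'' hne hx
      exact ⟨hx', by rw [hT.dist_of_mem_branch htt' hx']; exact Nat.lt_succ_self _⟩
    -- A heavy branch contains the node of some vertex of `c`, which makes the decrease strict.
    have hmem : ∃ x ∈ c.support, σ x ∈ D.tree.branch t' t'' := by
      have hpos : 0 < c.edgeCount (D.branchEdges t' t'') := by omega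
      rw [Walk.edgeCount, support_chainRestrict, Finset.card_pos] at hpos
      obtain ⟨e, he⟩ := hpos
      rw [Finset.mem_filter] at he
      obtain ⟨hec, x, hxe, hx⟩ := he
      refine ⟨x, ?_, mem_branch_of_mem_branchVerts hx (hσ x)⟩
      have := c.mem_edges_of_chain_ne_zero (Finsupp.mem_support_iff.1 hec)
      induction e with | _ a b
      rcases Sym2.mem_iff.1 hxe with rfl | rfl
      · exact c.fst_mem_support_of_mem_edges this
      · exact c.snd_mem_support_of_mem_edges this
    obtain ⟨x, hxc, hx⟩ := hmem
    refine Finset.sum_lt_sum (fun y _ => ?_) ⟨x, List.mem_toFinset.2 hxc, ?_⟩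
    · by_cases hy : σ y ∈ D.tree.branch t' t''
      · rw [if_pos hy, if_pos (hstep y hy).1]
        exact (hstep y hy).2.le
      · rw [if_neg hy]
        exact Nat.zero_le _
    · rw [if_pos hx, if_pos (hstep x hx).1]
      exact (hstep x hx).2
  obtain ⟨t⟩ := D.isTree.connected.nonempty
  obtain ⟨t', htt', hbig⟩ := hheavy t
  exact hno _ t t' htt' rfl hbig

end TreeDecomposition

/-! ### Attained infima and the conclusion -/

theorem exists_shortCycleSpan_eq {V : Type u} {G : SimpleGraph V} (h : G.cycleGenLength ≠ ⊤) :
    ∃ l : ℕ, G.cycleGenLength = l ∧ G.shortCycleSpan l = G.cycleSpace := by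
  have hne : ∃ l, G.shortCycleSpan l = G.cycleSpace := by
    by_contra! hcon
    exact h (by simp [cycleGenLength, hcon])
  classical
  refine ⟨Nat.find hne, le_antisymm ?_ ?_, Nat.find_spec hne⟩
  · exact iInf₂_le (f := fun (n : ℕ) (_ : G.shortCycleSpan n = G.cycleSpace) => (n : ℕ∞)) _
      (Nat.find_spec hne)
  · exact le_iInf₂ fun l hl => by exact_mod_cast Nat.find_min' hne hl

theorem exists_width_eq_treeWidth {V : Type u} {G : SimpleGraph V} (h : G.treeWidth ≠ ⊤) :
    ∃ D : G.TreeDecomposition, D.width = G.treeWidth := by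
  have : Nonempty G.TreeDecomposition := by
    by_contra hcon
    rw [not_nonempty_iff] at hcon
    exact h (by simp [treeWidth])
  exact ciInf_mem fun D : G.TreeDecomposition => D.width

end SimpleGraph

theorem mainTheorem4 {V : Type u} (G : SimpleGraph V) (k : ℕ)
    (h : ∃ (v : V) (c : G.Walk v v), G.IsGeodesicCycle c ∧ c.length = k) :
    (k : ℝ≥0∞) / (G.cycleGenLength : ℝ≥0∞) ≤ (G.treeWidth : ℝ≥0∞) := by
  obtain ⟨v, c, hc, rfl⟩ := h
  by_cases hl : G.cycleGenLength = ⊤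
  · simp [hl]
  by_cases ht : G.treeWidth = ⊤
  · simp [ht]
  obtain ⟨l, hl, hspan⟩ := SimpleGraph.exists_shortCycleSpan_eq hl
  obtain ⟨D, hD⟩ := SimpleGraph.exists_width_eq_treeWidth ht
  obtain ⟨w, hw⟩ := ENat.ne_top_iff_exists.1 ht
  have hpart : ∀ t, (D.part t).encard ≤ w + 1 := fun t => by
    rw [← tsub_le_iff_right, hw, ← hD]
    exact le_iSup (fun t => (D.part t).encard - 1) t
  have := D.length_le_of_isGeodesicCycle hc hpart (hc.1.chain_mem_span hspan)
  rw [hl, ← hw]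
  refine ENNReal.div_le_of_le_mul ?_
  simp only [ENat.toENNReal_coe]
  exact_mod_cast this
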